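/- **Fractional bilinear estimate.** For $f\in L^2(\mathbb R)=L^2(\mathbb R;\mathbb C)$ let $\hat f$ denote its Fourier transform, i.e. the $L^2$-extension of $\hat f(\eta)=\frac1{\sqrt{2\pi}}\int_{\mathbb R}e^{-ix\eta}f(x)\,dx$, and let $T_r=e^{ir\partial_x^2}$, $r\in\mathbb R$, be the free Schrödinger evolution on $L^2(\mathbb R)$, i.e. $\widehat{T_rf}(\eta)=e^{-ir\eta^2}\hat f(\eta)$. The function $(r,x)\mapsto T_rf(x)$ has a version that is measurable on $\mathbb R^2$ (unique up to null sets), and such versions are used below. The support $\operatorname{supp} g$ of a function $g$ defined almost everywhere is the complement of the largest open set on which $g=0$ almost everywhere, $\operatorname{dist}(A,B)=\inf\{|a-b|:a\in A,\ b\in B\}$ (with $\inf\emptyset=\infty$ and $\infty^{-\alpha}=0$ for $\alpha>0$), and $\|\cdot\|$ is the norm of $L^2(\mathbb R)$. Let $2\le p<3$. There is a constant $C<\infty$ depending only on $p$ such that for all $f_1,f_2\in L^2(\mathbb R)$ with $$s:=\operatorname{dist}(\operatorname{supp}\hat f_1,\operatorname{supp}\hat f_2)>0$$ one has $$\|T_rf_1\,T_rf_2\|_{L^p(\mathbb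 R^2,\,dx\,dr)}\le \frac{C}{s^{(3-p)/p}}\,\|f_1\|\,\|f_2\|.$$ -/

import Mathlib

open MeasureTheory Complex
open scoped ENNReal NNReal FourierTransform

noncomputable section

namespace FractionalBilinear

/-- The complex Hilbert space `L²(ℝ)` with respect to Lebesgue measure. -/
abbrev L2 : Type := Lp (α := ℝ) ℂ 2

/-- The Fourier transform of `f ∈ L²(ℝ)` in the unitary normalization
`f̂(η) = (2π)^{-1/2} ∫ e^{-i x η} f(x) dx` (extended to `L²` by Plancherel).
Mathlib's `𝓕` is the `L²` extension of `ξ ↦ ∫ e^{-2 π i x ξ} f(x) dx`, hence the rescaling.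
The function is determined up to a null set. -/
def hat (f : L2) : ℝ → ℂ :=
  fun η => ((Real.sqrt (2 * Real.pi))⁻¹ : ℝ) * (𝓕 f : L2) (η / (2 * Real.pi))

/-- The symbol of `e^{i r ∂ₓ²}`: the frequency `η = 2 π ξ` is multiplied by `e^{-i r η²}`. -/
def symbol (r : ℝ) (ξ : ℝ) : ℂ :=
  cexp (-(I * (r : ℂ) * ((2 * Real.pi * ξ : ℝ) : ℂ) ^ 2))

theorem norm_symbol (r ξ : ℝ) : ‖symbol r ξ‖ = 1 := by
  have h : -(I * (r : ℂ) * ((2 * Real.pi * ξ : ℝ) : ℂ) ^ 2)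
      = ((-(r * (2 * Real.pi * ξ) ^ 2) : ℝ) : ℂ) * I := by
    push_cast; ring
  rw [symbol, h, norm_exp_ofReal_mul_I]

theorem memLp_symbol_mul (r : ℝ) (g : L2) :
    MemLp (fun ξ => symbol r ξ * g ξ) 2 (volume : Measure ℝ) := by
  have hc : Continuous (symbol r) := by
    unfold symbol; fun_prop
  refine (Lp.memLp g).of_le
    (hc.aestronglyMeasurable.mul (Lp.aestronglyMeasurable g)) (ae_of_all _ fun ξ => ?_)
  rw [norm_mul, norm_symbol, one_mul]

/-- The free Schrödinger evolution `T_r = e^{i r ∂ₓ²}` on `L²(ℝ)`, the Fourier multiplier with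
symbol `e^{-i r η²}`. -/
def T (r : ℝ) (f : L2) : L2 :=
  𝓕⁻ ((memLp_symbol_mul r (𝓕 f)).toLp _)

/-- `u` is a version of `(r, x) ↦ T_r f (x)` as a measurable function on `ℝ²`. Two such versions
agree almost everywhere on `ℝ²`. -/
def IsFreeEvolution (f : L2) (u : ℝ × ℝ → ℂ) : Prop :=
  AEStronglyMeasurable u volume ∧ ∀ᵐ r : ℝ, ∀ᵐ x : ℝ, u (r, x) = T r f x

/-- The (essential) support of a function defined up to null sets: the complement of the largest
open set on which it vanishes almost everywhere. -/
def essSupport (g : ℝ → ℂ) : Set ℝ :=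
  {η | ∀ U : Set ℝ, IsOpen U → η ∈ U → 0 < volume (U ∩ Function.support g)}

/-- The distance `inf {|a - b| : a ∈ A, b ∈ B}` of two sets (it is `∞` if one of them is empty). -/
def setDist (A B : Set ℝ) : ℝ≥0∞ :=
  ⨅ a ∈ A, ⨅ b ∈ B, edist a b

end FractionalBilinear

end

noncomputable section

namespace FractionalBilinear

open Filter Topology

/-! A product of free evolutions is an oscillatory integral over the product of the frequency
spaces, with x dual to the sum of the frequencies and r dual to minus the sum of their squares.
After a linear change of variables one coordinate `a` carries the sum, and the sum of squares splits
into a multiple of `a ^ 2` plus a form `q` in the remaining coordinates. Plancherel in x removes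
`a`, and a Bessel inequality in r for the phase `r q` finishes:
`lintegral_enorm_sq_integral_prod_le`.

For two factors `q` is a multiple of `y ^ 2` with `y` half the frequency difference. Substituting σ
= `y ^ 2` costs the weight `|y|⁻¹`, so separated frequencies gain `s⁻¹` in the squared L² norm. For
three factors `q` is isotropic on a plane, where polar coordinates leave no weight; this is the L⁶
Strichartz inequality, which bounds the product in L³ by Cauchy–Schwarz. Hölder between L² and L³
gives the claim for integrable frequency data, and Fatou along frequency truncations extends it to
L². -/

/-! ### The inverse Fourier integral on L¹ ∩ L². -/

theorem integral_fourierInv_mul_eq {f g : ℝ → ℂ} (hf : Integrable f) (hg : Integrable g) :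
    ∫ x, 𝓕⁻ f x * g x = ∫ x, f x * 𝓕⁻ g x := by
  have hL : Continuous fun p : ℝ × ℝ => (-innerₗ ℝ) p.1 p.2 := by
    simp only [LinearMap.neg_apply, innerₗ_apply_apply]; fun_prop
  -- For the form `-innerₗ` the forward transform is `𝓕⁻`, and this form is its own flip.
  have h := VectorFourier.integral_fourierIntegral_smul_eq_flip (μ := (volume : Measure ℝ))
    (ν := (volume : Measure ℝ)) (L := -innerₗ ℝ) Real.continuous_fourierChar hL hf hg
  have key : ∀ (k : ℝ → ℂ) (x : ℝ),
      VectorFourier.fourierIntegral Real.fourierChar volume (-innerₗ ℝ) k x = 𝓕⁻ k x := by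
    intro k x
    simp [VectorFourier.fourierIntegral, Real.fourierInv_eq]
  have hflip : (-innerₗ ℝ : ℝ →ₗ[ℝ] ℝ →ₗ[ℝ] ℝ).flip = -innerₗ ℝ := by
    ext; simp
  rw [hflip] at h
  simpa only [key, smul_eq_mul] using h

theorem continuous_fourierInv {h : ℝ → ℂ} (hh : Integrable h) : Continuous (𝓕⁻ h) := by
  have : (𝓕⁻ h) = fun x => 𝓕 h (-x) := by ext x; rw [Real.fourierInv_eq_fourier_neg]
  rw [this]
  exact (VectorFourier.fourierIntegral_continuous Real.continuous_fourierChar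
    (by exact continuous_inner) hh).comp continuous_neg

/-- On `L¹ ∩ L²` the `L²` inverse Fourier transform is given by the integral. -/
theorem fourierInv_toLp_ae_eq {h : ℝ → ℂ} (h1 : Integrable h) (h2 : MemLp h 2) :
    ((𝓕⁻ (h2.toLp h) : L2) : ℝ → ℂ) =ᵐ[volume] 𝓕⁻ h := by
  have hcont := continuous_fourierInv h1
  refine ae_eq_of_integral_contDiff_smul_eq
    ((Lp.memLp (𝓕⁻ (h2.toLp h) : L2)).locallyIntegrable (by norm_num))
    hcont.locallyIntegrable ?_
  intro g hg hgs
  have hg1 : ContDiff ℝ ((⊤ : ℕ∞) : WithTop ℕ∞) (fun x => (g x : ℂ)) := by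
    exact Complex.ofRealCLM.contDiff.comp hg
  have hg2 : HasCompactSupport (fun x => (g x : ℂ)) := hgs.comp_left (g := ((↑) : ℝ → ℂ)) (by simp)
  set φ := hg2.toSchwartzMap hg1 with hφ
  have hφg : ∀ x, φ x = (g x : ℂ) := fun x => rfl
  -- Both transforms agree as tempered distributions; pairing with test functions identifies them
  -- almost everywhere.
  have e := congrArg (fun t => t φ) (Lp.fourierInv_toTemperedDistribution_eq (h2.toLp h))
  simp only [TemperedDistribution.fourierInv_apply, Lp.toTemperedDistribution_apply] at e
  have e2 : ∫ x, (𝓕⁻ φ) x • (h2.toLp h) x = ∫ x, h x * 𝓕⁻ (φ : ℝ → ℂ) x := by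
    refine integral_congr_ae ?_
    filter_upwards [h2.coeFn_toLp] with x hx
    rw [hx, smul_eq_mul, mul_comm, SchwartzMap.fourierInv_coe]
  rw [e2, ← integral_fourierInv_mul_eq h1 φ.integrable] at e
  simp only [hφg, smul_eq_mul] at e
  calc ∫ x, g x • (𝓕⁻ (h2.toLp h) : L2) x = ∫ x, (g x : ℂ) * (𝓕⁻ (h2.toLp h) : L2) x := by
        simp
    _ = ∫ x, 𝓕⁻ h x * (g x : ℂ) := e.symm
    _ = _ := by simp [mul_comm]

/-- Plancherel if `h` is in L²; otherwise the right side is infinite. -/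
theorem lintegral_enorm_sq_fourierInv_le {h : ℝ → ℂ} (h1 : Integrable h) :
    ∫⁻ x, ‖𝓕⁻ h x‖ₑ ^ 2 ≤ ∫⁻ x, ‖h x‖ₑ ^ 2 := by
  by_cases h2 : MemLp h 2
  · have e1 : ∀ k : ℝ → ℂ, ∫⁻ x, ‖k x‖ₑ ^ 2 = eLpNorm k 2 volume ^ 2 := by
      intro k
      have := eLpNorm_nnreal_pow_eq_lintegral (f := k) (μ := volume) (p := 2) (by norm_num)
      simp only [NNReal.coe_ofNat, ENNReal.coe_ofNat] at this
      exact_mod_cast this.symm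
    rw [e1, e1, ← eLpNorm_congr_ae (fourierInv_toLp_ae_eq h1 h2), ← eLpNorm_congr_ae h2.coeFn_toLp,
      ← Lp.enorm_def, ← Lp.enorm_def]
    have : ‖(𝓕⁻ (h2.toLp h) : L2)‖ = ‖h2.toLp h‖ :=
      (Lp.fourierTransformₗᵢ ℝ ℂ).symm.norm_map _
    rw [← ofReal_norm, this, ofReal_norm]
  · have : ∫⁻ x, ‖h x‖ₑ ^ 2 = ⊤ := by
      by_contra hne
      refine h2 ⟨h1.1, ?_⟩
      rw [eLpNorm_lt_top_iff_lintegral_rpow_enorm_lt_top (by norm_num) (by norm_num)]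
      simpa using lt_top_iff_ne_top.2 hne
    rw [this]; exact le_top

/-! ### Bessel inequalities for linear and quadratic phases. -/

/-- The conjugate phase undoes a unimodular factor. Hence a non-integrable amplitude gives an
oscillatory integral with default value `0`, and the Bessel inequalities in r alone need no
integrability hypothesis. -/
theorem integrable_cexp_mul_iff {α : Type*} [MeasurableSpace α] {μ : Measure α} {q : α → ℝ}
    (hq : Measurable q) {h : α → ℂ} :
    Integrable (fun v => cexp (I * (q v : ℝ)) * h v) μ ↔ Integrable h μ := by
  have key : ∀ q : α → ℝ, Measurable q → ∀ h : α → ℂ, Integrable h μ →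
      Integrable (fun v => cexp (I * (q v : ℝ)) * h v) μ := by
    intro q hq h hh
    refine hh.bdd_mul (c := 1) (by fun_prop) (ae_of_all _ fun v => ?_)
    rw [mul_comm, norm_exp_ofReal_mul_I]
  refine ⟨fun hh => ?_, key q hq h⟩
  have := key (fun v => - q v) hq.neg _ hh
  refine this.congr (ae_of_all _ fun v => ?_)
  simp only [← mul_assoc, ← Complex.exp_add]
  simp

/-- One-dimensional Bessel inequality with frequency scaling. -/
theorem lintegral_enorm_sq_integral_cexp_le {k : ℝ} (hk : k ≠ 0) (h : ℝ → ℂ) :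
    ∫⁻ r : ℝ, ‖∫ y, cexp (I * ((r * (k * y) : ℝ) : ℂ)) * h y‖ₑ ^ 2
      ≤ ENNReal.ofReal (2 * Real.pi / |k|) * ∫⁻ y, ‖h y‖ₑ ^ 2 := by
  by_cases h1 : Integrable h
  · have e : ∀ r : ℝ, ∫ y, cexp (I * ((r * (k * y) : ℝ) : ℂ)) * h y
        = 𝓕⁻ h (k / (2 * Real.pi) * r) := by
      intro r
      rw [Real.fourierInv_eq']
      refine integral_congr_ae (ae_of_all _ fun y => ?_)
      simp only [smul_eq_mul, RCLike.inner_apply, conj_trivial]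
      congr 2
      push_cast
      have : (Real.pi : ℂ) ≠ 0 := by exact_mod_cast Real.pi_ne_zero
      field_simp
    simp only [e]
    have hk' : k / (2 * Real.pi) ≠ 0 := by positivity
    have hm : Measurable fun x => ‖𝓕⁻ h x‖ₑ ^ 2 := by
      have := (continuous_fourierInv h1).measurable
      fun_prop
    have hs : |(k / (2 * Real.pi))⁻¹| = 2 * Real.pi / |k| := by
      rw [inv_div, abs_div, abs_of_pos Real.two_pi_pos]
    rw [← lintegral_map (f := fun x => ‖𝓕⁻ h x‖ₑ ^ 2) hm
      (measurable_const_mul (k / (2 * Real.pi))), Real.map_volume_mul_left hk',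
      lintegral_smul_measure, smul_eq_mul, hs]
    exact mul_le_mul' le_rfl (lintegral_enorm_sq_fourierInv_le h1)
  · have : ∀ r : ℝ, ∫ y, cexp (I * ((r * (k * y) : ℝ) : ℂ)) * h y = 0 := by
      intro r
      refine integral_undef ?_
      rwa [integrable_cexp_mul_iff (by fun_prop)]
    simp only [this]
    simp

theorem enorm_cexp_I_mul_ofReal (t : ℝ) : ‖cexp (I * (t : ℂ))‖ₑ = 1 := by
  rw [← ofReal_norm, mul_comm, norm_exp_ofReal_mul_I, ENNReal.ofReal_one]

theorem image_sq_Ioi : (fun y : ℝ => y ^ 2) '' Set.Ioi 0 = Set.Ioi 0 := by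
  ext σ
  simp only [Set.mem_image, Set.mem_Ioi]
  constructor
  · rintro ⟨y, hy, rfl⟩; positivity
  · intro h; exact ⟨√σ, Real.sqrt_pos.2 h, Real.sq_sqrt h.le⟩

theorem injOn_sq_Ioi : Set.InjOn (fun y : ℝ => y ^ 2) (Set.Ioi 0) := by
  intro a ha b hb h
  exact (sq_eq_sq₀ (le_of_lt ha) (le_of_lt hb)).1 h

theorem hasDerivWithinAt_sq (s : Set ℝ) (y : ℝ) :
    HasDerivWithinAt (fun y : ℝ => y ^ 2) (2 * y) s y := by
  simpa using (hasDerivAt_pow 2 y).hasDerivWithinAt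

/-- Bessel inequality for the phase `r y²` on the half-line. -/
theorem lintegral_enorm_sq_integral_Ioi_cexp_sq_le {k : ℝ} (hk : k ≠ 0) (h : ℝ → ℂ) :
    ∫⁻ r : ℝ, ‖∫ y in Set.Ioi 0, cexp (I * ((r * (k * y ^ 2) : ℝ) : ℂ)) * h y‖ₑ ^ 2
      ≤ ENNReal.ofReal (2 * Real.pi / |k|) *
        ∫⁻ y in Set.Ioi 0, ‖h y‖ₑ ^ 2 * ENNReal.ofReal y⁻¹ := by
  -- With σ = y² the phase is linear and the amplitude gains the factor 1/(2y). Its square against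
  -- dσ = 2y dy leaves 1/(2y), which is at most 1/y.
  set H : ℝ → ℂ := (Set.Ioi 0).indicator fun σ => h √σ * ((2 * √σ : ℝ) : ℂ)⁻¹ with hH
  have e : ∀ r : ℝ, ∫ y in Set.Ioi 0, cexp (I * ((r * (k * y ^ 2) : ℝ) : ℂ)) * h y
      = ∫ σ, cexp (I * ((r * (k * σ) : ℝ) : ℂ)) * H σ := by
    intro r
    have e1 : ∫ σ, cexp (I * ((r * (k * σ) : ℝ) : ℂ)) * H σ
        = ∫ σ in Set.Ioi 0, cexp (I * ((r * (k * σ) : ℝ) : ℂ)) *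
            (h √σ * ((2 * √σ : ℝ) : ℂ)⁻¹) := by
      rw [← integral_indicator measurableSet_Ioi]
      refine integral_congr_ae (ae_of_all _ fun σ => ?_)
      by_cases hσ : σ ∈ Set.Ioi (0 : ℝ) <;> simp [hH, hσ]
    rw [e1]
    conv_rhs => rw [← image_sq_Ioi]
    rw [integral_image_eq_integral_abs_deriv_smul measurableSet_Ioi
      (fun y _ => hasDerivWithinAt_sq _ y) injOn_sq_Ioi]
    refine setIntegral_congr_fun measurableSet_Ioi fun y hy => ?_
    have hy' : 0 < y := hy
    have hy2 : ((2 * y : ℝ) : ℂ) ≠ 0 := by exact_mod_cast (by positivity : (2 * y : ℝ) ≠ 0)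
    simp only [Real.sqrt_sq hy'.le, abs_of_pos (by positivity : 0 < 2 * y), real_smul]
    generalize ((2 * y : ℝ) : ℂ) = t at hy2 ⊢
    field_simp
  simp only [e]
  refine (lintegral_enorm_sq_integral_cexp_le hk H).trans (mul_le_mul' le_rfl ?_)
  have e2 : ∫⁻ σ, ‖H σ‖ₑ ^ 2 = ∫⁻ σ in Set.Ioi 0, ‖h √σ * ((2 * √σ : ℝ) : ℂ)⁻¹‖ₑ ^ 2 := by
    rw [← lintegral_indicator measurableSet_Ioi]
    refine lintegral_congr fun σ => ?_
    by_cases hσ : σ ∈ Set.Ioi (0 : ℝ) <;> simp [hH, hσ]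
  rw [e2]
  conv_lhs => rw [← image_sq_Ioi]
  rw [lintegral_image_eq_lintegral_abs_deriv_mul measurableSet_Ioi
      (fun y _ => hasDerivWithinAt_sq _ y) injOn_sq_Ioi]
  refine setLIntegral_mono' measurableSet_Ioi fun y hy => ?_
  have hy' : 0 < y := hy
  rw [Real.sqrt_sq hy'.le, abs_of_pos (by positivity : 0 < 2 * y), enorm_mul, mul_pow,
    mul_left_comm]
  refine mul_le_mul' le_rfl ?_
  rw [← ofReal_norm, norm_inv, norm_real, Real.norm_of_nonneg (by positivity),
    ← ENNReal.ofReal_pow (by positivity), ← ENNReal.ofReal_mul (by positivity)]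
  refine ENNReal.ofReal_le_ofReal ?_
  have : 2 * y * (2 * y)⁻¹ ^ 2 = (2 : ℝ)⁻¹ * y⁻¹ := by field_simp
  rw [this]
  have : 0 < y⁻¹ := by positivity
  linarith

theorem enorm_add_sq_le (a b : ℂ) : ‖a + b‖ₑ ^ 2 ≤ 2 * (‖a‖ₑ ^ 2 + ‖b‖ₑ ^ 2) := by
  have h : ‖a + b‖ ^ 2 ≤ 2 * (‖a‖ ^ 2 + ‖b‖ ^ 2) := by
    nlinarith [norm_add_le a b, sq_nonneg (‖a‖ - ‖b‖), norm_nonneg (a + b)]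
  simp only [← ofReal_norm]
  rw [← ENNReal.ofReal_pow (norm_nonneg _), ← ENNReal.ofReal_pow (norm_nonneg _),
    ← ENNReal.ofReal_pow (norm_nonneg _), ← ENNReal.ofReal_add (by positivity) (by positivity),
    ← ENNReal.ofReal_ofNat 2, ← ENNReal.ofReal_mul (by positivity)]
  exact ENNReal.ofReal_le_ofReal h

theorem measurable_integral_cexp_mul {V W : Type*} [MeasurableSpace W] [MeasureSpace V]
    [SFinite (volume : Measure V)] {q : W → V → ℝ} (hq : Measurable (Function.uncurry q))
    {F : W → V → ℂ} (hF : Measurable (Function.uncurry F)) :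
    Measurable fun w => ∫ v, cexp (I * (q w v : ℝ)) * F w v := by
  have : StronglyMeasurable (Function.uncurry fun w v => cexp (I * (q w v : ℝ)) * F w v) := by
    refine Measurable.stronglyMeasurable ?_
    change Measurable fun z : W × V => cexp (I * (Function.uncurry q z : ℝ)) * Function.uncurry F z
    fun_prop
  exact this.integral_prod_right.measurable

/-- Bessel inequality for the phase `r y²` on the line. -/
theorem lintegral_enorm_sq_integral_cexp_sq_le {k : ℝ} (hk : k ≠ 0) {h : ℝ → ℂ}
    (hh : Measurable h) :
    ∫⁻ r : ℝ, ‖∫ y, cexp (I * ((r * (k * y ^ 2) : ℝ) : ℂ)) * h y‖ₑ ^ 2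
      ≤ ENNReal.ofReal (4 * Real.pi / |k|) * ∫⁻ y, ‖h y‖ₑ ^ 2 * ENNReal.ofReal |y|⁻¹ := by
  by_cases h1 : Integrable h
  -- The phase is even, so the negative half-line folds onto the positive one; squaring the sum of
  -- two terms doubles the constant.
  · have e : ∀ r : ℝ, ∫ y, cexp (I * ((r * (k * y ^ 2) : ℝ) : ℂ)) * h y
        = (∫ y in Set.Ioi 0, cexp (I * ((r * (k * y ^ 2) : ℝ) : ℂ)) * h y)
          + ∫ y in Set.Ioi 0, cexp (I * ((r * (k * y ^ 2) : ℝ) : ℂ)) * h (-y) := by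
      intro r
      have hi : Integrable fun y => cexp (I * ((r * (k * y ^ 2) : ℝ) : ℂ)) * h y :=
        (integrable_cexp_mul_iff (by fun_prop)).2 h1
      rw [← integral_add_compl (s := Set.Ioi 0) measurableSet_Ioi hi, Set.compl_Ioi]
      congr 1
      have := integral_comp_neg_Ioi (0 : ℝ)
        (fun y => cexp (I * ((r * (k * y ^ 2) : ℝ) : ℂ)) * h y)
      simp only [neg_zero, neg_sq] at this
      exact this.symm
    have m1 : Measurable fun r : ℝ =>
        ∫ y in Set.Ioi 0, cexp (I * ((r * (k * y ^ 2) : ℝ) : ℂ)) * h y := by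
      have : StronglyMeasurable (Function.uncurry fun (r y : ℝ) =>
          cexp (I * ((r * (k * y ^ 2) : ℝ) : ℂ)) * h y) := by
        refine Measurable.stronglyMeasurable ?_
        unfold Function.uncurry
        fun_prop
      exact this.integral_prod_right.measurable
    calc _ ≤ ∫⁻ r : ℝ, 2 * (‖∫ y in Set.Ioi 0, cexp (I * ((r * (k * y ^ 2) : ℝ) : ℂ)) * h y‖ₑ ^ 2
          + ‖∫ y in Set.Ioi 0, cexp (I * ((r * (k * y ^ 2) : ℝ) : ℂ)) * h (-y)‖ₑ ^ 2) := by
          refine lintegral_mono fun r => ?_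
          simp only [e]
          exact enorm_add_sq_le _ _
      _ = 2 * ((∫⁻ r : ℝ, ‖∫ y in Set.Ioi 0, cexp (I * ((r * (k * y ^ 2) : ℝ) : ℂ)) * h y‖ₑ ^ 2)
          + ∫⁻ r : ℝ,
            ‖∫ y in Set.Ioi 0, cexp (I * ((r * (k * y ^ 2) : ℝ) : ℂ)) * h (-y)‖ₑ ^ 2) := by
          rw [lintegral_const_mul' _ _ (by norm_num), lintegral_add_left (by fun_prop)]
      _ ≤ 2 * (ENNReal.ofReal (2 * Real.pi / |k|) *
            (∫⁻ y in Set.Ioi 0, ‖h y‖ₑ ^ 2 * ENNReal.ofReal y⁻¹) +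
          ENNReal.ofReal (2 * Real.pi / |k|) *
            ∫⁻ y in Set.Ioi 0, ‖h (-y)‖ₑ ^ 2 * ENNReal.ofReal y⁻¹) := by
          exact mul_le_mul' le_rfl (add_le_add (lintegral_enorm_sq_integral_Ioi_cexp_sq_le hk h)
            (lintegral_enorm_sq_integral_Ioi_cexp_sq_le hk fun y => h (-y)))
      _ = _ := by
          rw [← mul_add, ← mul_assoc]
          congr 1
          · rw [← ENNReal.ofReal_ofNat 2, ← ENNReal.ofReal_mul (by positivity)]
            congr 1; ring
          · rw [← lintegral_add_compl (fun y => ‖h y‖ₑ ^ 2 * ENNReal.ofReal |y|⁻¹)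
              (measurableSet_Ioi (a := (0 : ℝ))), Set.compl_Ioi]
            congr 1
            · refine setLIntegral_congr_fun measurableSet_Ioi fun y hy => ?_
              simp only [abs_of_pos (Set.mem_Ioi.1 hy)]
            · have hn := (Measure.measurePreserving_neg (volume : Measure ℝ)).setLIntegral_comp_preimage
                (measurableSet_Iio (a := (0 : ℝ)))
                (f := fun y => ‖h y‖ₑ ^ 2 * ENNReal.ofReal |y|⁻¹) (by fun_prop)
              rw [setLIntegral_congr (Iio_ae_eq_Iic (a := (0 : ℝ)))] at hn
              rw [← hn]
              have : (fun y : ℝ => -y) ⁻¹' Set.Iio 0 = Set.Ioi 0 := by ext; simp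
              change _ = ∫⁻ y in (fun y : ℝ => -y) ⁻¹' Set.Iio 0, _
              rw [this]
              refine setLIntegral_congr_fun measurableSet_Ioi fun y hy => ?_
              simp only [abs_neg, abs_of_pos (Set.mem_Ioi.1 hy)]
  · have : ∀ r : ℝ, ∫ y, cexp (I * ((r * (k * y ^ 2) : ℝ) : ℂ)) * h y = 0 := by
      intro r
      refine integral_undef ?_
      rwa [integrable_cexp_mul_iff (by fun_prop)]
    simp only [this]
    simp

/-- If the phase `r q` on `V` satisfies a weighted Bessel inequality, then so does the phase
`x k a + r (c a² + q)` on `ℝ × V`. -/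
theorem lintegral_enorm_sq_integral_prod_le {V : Type*} [MeasureSpace V]
    [SFinite (volume : Measure V)] {q : V → ℝ} (hq : Measurable q) {w : V → ℝ≥0∞}
    (hw : Measurable w)
    (H : ∀ h : V → ℂ, Measurable h →
      ∫⁻ r : ℝ, ‖∫ v, cexp (I * ((r * q v : ℝ) : ℂ)) * h v‖ₑ ^ 2 ≤ ∫⁻ v, ‖h v‖ₑ ^ 2 * w v)
    {k : ℝ} (hk : k ≠ 0) (c : ℝ) {F : ℝ × V → ℂ} (hFm : Measurable F) (hF : Integrable F) :
    ∫⁻ r : ℝ, ∫⁻ x : ℝ,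
        ‖∫ z : ℝ × V, cexp (I * ((x * (k * z.1) + r * (c * z.1 ^ 2 + q z.2) : ℝ) : ℂ)) * F z‖ₑ ^ 2
      ≤ ENNReal.ofReal (2 * Real.pi / |k|) * ∫⁻ z : ℝ × V, ‖F z‖ₑ ^ 2 * w z.2 := by
  -- For fixed r the integral is a Fourier integral in `a` of `G r a` times a unimodular factor.
  -- Plancherel in x discards that factor, and after Tonelli `H` applies in r for each fixed `a`.
  set G : ℝ → ℝ → ℂ := fun r a => ∫ v, cexp (I * ((r * q v : ℝ) : ℂ)) * F (a, v) with hG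
  have hGm : Measurable (Function.uncurry G) := by
    exact measurable_integral_cexp_mul (q := fun (z : ℝ × ℝ) v => z.1 * q v)
      (F := fun (z : ℝ × ℝ) v => F (z.2, v)) (by unfold Function.uncurry; fun_prop)
      (by unfold Function.uncurry; fun_prop)
  have e : ∀ r x : ℝ,
      ∫ z : ℝ × V, cexp (I * ((x * (k * z.1) + r * (c * z.1 ^ 2 + q z.2) : ℝ) : ℂ)) * F z
      = ∫ a, cexp (I * ((x * (k * a) : ℝ) : ℂ)) *
          (cexp (I * ((r * (c * a ^ 2) : ℝ) : ℂ)) * G r a) := by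
    intro r x
    have hi : Integrable fun z : ℝ × V =>
        cexp (I * ((x * (k * z.1) + r * (c * z.1 ^ 2 + q z.2) : ℝ) : ℂ)) * F z :=
      (integrable_cexp_mul_iff (by fun_prop)).2 hF
    rw [Measure.volume_eq_prod] at hi ⊢
    rw [integral_prod _ hi]
    refine integral_congr_ae (ae_of_all _ fun a => ?_)
    simp only [hG, ← integral_const_mul]
    refine integral_congr_ae (ae_of_all _ fun v => ?_)
    simp only [← mul_assoc, ← Complex.exp_add]
    congr 2
    push_cast; ring
  calc _ ≤ ∫⁻ r : ℝ, ENNReal.ofReal (2 * Real.pi / |k|) * ∫⁻ a, ‖G r a‖ₑ ^ 2 := by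
        refine lintegral_mono fun r => ?_
        simp only [e]
        refine (lintegral_enorm_sq_integral_cexp_le hk _).trans_eq ?_
        simp only [enorm_mul, enorm_cexp_I_mul_ofReal, one_mul]
    _ = ENNReal.ofReal (2 * Real.pi / |k|) * ∫⁻ a, ∫⁻ r, ‖G r a‖ₑ ^ 2 := by
        rw [lintegral_const_mul' _ _ ENNReal.ofReal_ne_top, lintegral_lintegral_swap]
        exact (hGm.enorm.pow_const 2).aemeasurable
    _ ≤ ENNReal.ofReal (2 * Real.pi / |k|) * ∫⁻ a, ∫⁻ v, ‖F (a, v)‖ₑ ^ 2 * w v := by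
        refine mul_le_mul' le_rfl (lintegral_mono fun a => H _ (by fun_prop))
    _ = _ := by
        rw [Measure.volume_eq_prod, lintegral_prod]
        exact ((hFm.enorm.pow_const 2).mul (hw.comp measurable_snd)).aemeasurable

theorem lintegral_sq_le {α : Type*} [MeasurableSpace α] {μ : Measure α} {f : α → ℝ≥0∞}
    (hf : AEMeasurable f μ) : (∫⁻ a, f a ∂μ) ^ 2 ≤ μ Set.univ * ∫⁻ a, f a ^ 2 ∂μ := by
  have := ENNReal.lintegral_mul_norm_pow_le (μ := μ) (f := fun _ => 1) (g := fun a => f a ^ 2)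
    aemeasurable_const (hf.pow_const 2) (p := 1 / 2) (q := 1 / 2) (by norm_num) (by norm_num)
    (by norm_num)
  have e : ∀ x : ℝ≥0∞, (x ^ 2) ^ (1 / 2 : ℝ) = x := fun x => by
    rw [← ENNReal.rpow_natCast, ← ENNReal.rpow_mul]; norm_num
  have e' : ∀ x : ℝ≥0∞, (x ^ (1 / 2 : ℝ)) ^ 2 = x := fun x => by
    rw [← ENNReal.rpow_natCast, ← ENNReal.rpow_mul]; norm_num
  simp only [e, ENNReal.one_rpow, one_mul, lintegral_const] at this
  calc _ ≤ _ := pow_le_pow_left' this 2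
    _ = _ := by rw [mul_pow, e', e']

/-- Bessel inequality for the phase `r |z|²` on the plane. -/
theorem lintegral_enorm_sq_integral_cexp_plane_le {k : ℝ} (hk : k ≠ 0) {h : ℝ × ℝ → ℂ}
    (hh : Measurable h) :
    ∫⁻ r : ℝ, ‖∫ z : ℝ × ℝ, cexp (I * ((r * (k * (z.1 ^ 2 + z.2 ^ 2)) : ℝ) : ℂ)) * h z‖ₑ ^ 2
      ≤ ENNReal.ofReal (2 * Real.pi / |k|) * ENNReal.ofReal (2 * Real.pi) * ∫⁻ z, ‖h z‖ₑ ^ 2 := by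
  by_cases h1 : Integrable h
  -- The phase is radial, so only the angular integral `A` matters. The half-line inequality for the
  -- amplitude `ρ * A ρ` carries the weight 1/ρ, which reduces ρ² to the polar Jacobian ρ.
  · set A : ℝ → ℂ := fun ρ => ∫ θ in Set.Ioo (-Real.pi) Real.pi, h (polarCoord.symm (ρ, θ)) with hA
    have hpm : Measurable polarCoord.symm := continuous_polarCoord_symm.measurable
    have hnorm : ∀ p : ℝ × ℝ, (polarCoord.symm p).1 ^ 2 + (polarCoord.symm p).2 ^ 2 = p.1 ^ 2 := by
      intro p
      simp only [polarCoord_symm_apply]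
      linear_combination p.1 ^ 2 * Real.cos_sq_add_sin_sq p.2
    have ht : polarCoord.target = Set.Ioi (0 : ℝ) ×ˢ Set.Ioo (-Real.pi) Real.pi := rfl
    have e : ∀ r : ℝ,
        ∫ z : ℝ × ℝ, cexp (I * ((r * (k * (z.1 ^ 2 + z.2 ^ 2)) : ℝ) : ℂ)) * h z
        = ∫ ρ in Set.Ioi 0, cexp (I * ((r * (k * ρ ^ 2) : ℝ) : ℂ)) * ((ρ : ℂ) * A ρ) := by
      intro r
      have hi : Integrable fun z : ℝ × ℝ =>
          cexp (I * ((r * (k * (z.1 ^ 2 + z.2 ^ 2)) : ℝ) : ℂ)) * h z :=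
        (integrable_cexp_mul_iff (by fun_prop)).2 h1
      have hi2 : IntegrableOn (fun p : ℝ × ℝ => p.1 • (cexp (I * ((r * (k * p.1 ^ 2) : ℝ) : ℂ)) *
          h (polarCoord.symm p))) polarCoord.target := by
        refine ⟨by fun_prop, ?_⟩
        have := hi.2
        rw [HasFiniteIntegral, ← lintegral_comp_polarCoord_symm] at this
        simp only [hnorm] at this
        refine lt_of_le_of_lt (setLIntegral_mono' polarCoord.open_target.measurableSet
          fun p hp => ?_) this
        rw [enorm_smul, smul_eq_mul]
        refine mul_le_mul' ?_ le_rfl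
        rw [← ofReal_norm, Real.norm_of_nonneg (le_of_lt hp.1)]
      rw [← integral_comp_polarCoord_symm]
      simp only [hnorm]
      rw [ht] at hi2 ⊢
      rw [Measure.volume_eq_prod] at hi2 ⊢
      rw [setIntegral_prod _ hi2]
      refine setIntegral_congr_fun measurableSet_Ioi fun ρ hρ => ?_
      simp only [hA, ← integral_const_mul]
      refine integral_congr_ae (ae_of_all _ fun θ => ?_)
      simp only [real_smul]
      ring
    simp only [e]
    refine (lintegral_enorm_sq_integral_Ioi_cexp_sq_le hk _).trans ?_
    rw [mul_assoc]
    refine mul_le_mul' le_rfl ?_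
    rw [← lintegral_comp_polarCoord_symm, ht, Measure.volume_eq_prod, setLIntegral_prod _ (by fun_prop)]
    rw [← lintegral_const_mul' _ _ ENNReal.ofReal_ne_top]
    refine setLIntegral_mono' measurableSet_Ioi fun ρ hρ => ?_
    have hρ' : 0 < ρ := hρ
    -- Cauchy–Schwarz in the angle, over an interval of length 2π.
    have hAle : ‖A ρ‖ₑ ^ 2 ≤ ENNReal.ofReal (2 * Real.pi) *
        ∫⁻ θ in Set.Ioo (-Real.pi) Real.pi, ‖h (polarCoord.symm (ρ, θ))‖ₑ ^ 2 := by
      refine (pow_le_pow_left' (enorm_integral_le_lintegral_enorm _) 2).trans ?_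
      refine (lintegral_sq_le (by fun_prop)).trans_eq ?_
      rw [Measure.restrict_apply_univ, Real.volume_Ioo]
      congr 2; ring
    simp only [smul_eq_mul]
    rw [lintegral_const_mul' _ _ ENNReal.ofReal_ne_top, enorm_mul, mul_pow]
    calc _ = ‖(ρ : ℂ)‖ₑ ^ 2 * ENNReal.ofReal ρ⁻¹ * ‖A ρ‖ₑ ^ 2 := by ring
      _ = ENNReal.ofReal ρ * ‖A ρ‖ₑ ^ 2 := by
          rw [← ofReal_norm, norm_real, Real.norm_of_nonneg hρ'.le, ← ENNReal.ofReal_pow hρ'.le,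
            ← ENNReal.ofReal_mul (by positivity)]
          congr 2; field_simp
      _ ≤ _ := by
          rw [mul_left_comm]
          exact mul_le_mul' le_rfl hAle
  · have : ∀ r : ℝ,
        ∫ z : ℝ × ℝ, cexp (I * ((r * (k * (z.1 ^ 2 + z.2 ^ 2)) : ℝ) : ℂ)) * h z = 0 := by
      intro r
      refine integral_undef ?_
      rwa [integrable_cexp_mul_iff (by fun_prop)]
    simp only [this]
    simp

/-! ### Linear changes of the frequency variables. -/

theorem map_linearEquiv_volume {E : Type*} [NormedAddCommGroup E] [NormedSpace ℝ E]
    [FiniteDimensional ℝ E] [MeasureSpace E] [BorelSpace E]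
    [(volume : Measure E).IsAddHaarMeasure] (e : E ≃ₗ[ℝ] E) :
    ∃ c : ℝ≥0, c ≠ 0 ∧ (volume : Measure E).map e = c • volume := by
  have hdet : LinearMap.det (e : E →ₗ[ℝ] E) ≠ 0 := (LinearEquiv.isUnit_det' e).ne_zero
  refine ⟨|(LinearMap.det (e : E →ₗ[ℝ] E))⁻¹|.toNNReal, ?_, ?_⟩
  · simpa using hdet
  · exact Measure.map_linearMap_addHaar_eq_smul_addHaar volume hdet

/-- The weighted Bessel inequality on `ℝ × V` after a linear change of variables `e`. -/
theorem exists_lintegral_enorm_sq_integral_le {V : Type*} [NormedAddCommGroup V] [NormedSpace ℝ V]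
    [FiniteDimensional ℝ V] [MeasureSpace V] [BorelSpace V] [SecondCountableTopology V]
    [(volume : Measure V).IsAddHaarMeasure] {q : V → ℝ} (hq : Measurable q) {w : V → ℝ≥0∞}
    (hw : Measurable w)
    (H : ∀ h : V → ℂ, Measurable h →
      ∫⁻ r : ℝ, ‖∫ v, cexp (I * ((r * q v : ℝ) : ℂ)) * h v‖ₑ ^ 2 ≤ ∫⁻ v, ‖h v‖ₑ ^ 2 * w v)
    {k : ℝ} (hk : k ≠ 0) (c : ℝ) (e : (ℝ × V) ≃ₗ[ℝ] (ℝ × V)) {S Q : ℝ × V → ℝ}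
    (hS : ∀ z, S (e z) = k * z.1) (hQ : ∀ z, Q (e z) = c * z.1 ^ 2 + q z.2) :
    ∃ C : ℝ≥0, ∀ G : ℝ × V → ℂ, Measurable G → Integrable G →
      ∫⁻ r : ℝ, ∫⁻ x : ℝ, ‖∫ z, cexp (I * ((x * S z + r * Q z : ℝ) : ℂ)) * G z‖ₑ ^ 2
        ≤ C * ∫⁻ z, ‖G z‖ₑ ^ 2 * w (e.symm z).2 := by
  have : (volume : Measure (ℝ × V)).IsAddHaarMeasure := by
    rw [Measure.volume_eq_prod]; infer_instance
  obtain ⟨d, hd0, hd⟩ := map_linearEquiv_volume e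
  have hec : Continuous e := e.toLinearMap.continuous_of_finiteDimensional
  have hem : MeasurableEmbedding e :=
    e.toContinuousLinearEquiv.toHomeomorph.measurableEmbedding
  -- The change of variables puts `d⁻¹` on the oscillatory integral, squared on the left, and `d` on
  -- the right; 2π/|k| comes from Plancherel in x.
  refine ⟨(d⁻¹) ^ 2 * ((2 * Real.pi / |k|).toNNReal * d), fun G hGm hG => ?_⟩
  have hGe : Integrable (fun z => G (e z)) := by
    have : Integrable G (Measure.map e volume) := by
      rw [hd]; exact hG.smul_measure_nnreal
    exact hem.integrable_map_iff.1 this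
  have e1 : ∀ r x : ℝ, ∫ z, cexp (I * ((x * S z + r * Q z : ℝ) : ℂ)) * G z
      = (d : ℝ)⁻¹ • ∫ z : ℝ × V,
        cexp (I * ((x * (k * z.1) + r * (c * z.1 ^ 2 + q z.2) : ℝ) : ℂ)) * G (e z) := by
    intro r x
    have := hem.integral_map (μ := volume)
      (fun z => cexp (I * ((x * S z + r * Q z : ℝ) : ℂ)) * G z)
    rw [hd, integral_smul_nnreal_measure] at this
    simp only [hS, hQ] at this
    rw [← this, NNReal.smul_def, smul_smul, inv_mul_cancel₀ (by exact_mod_cast hd0), one_smul]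
  have hdn : ‖(d : ℝ)⁻¹‖ₑ = ((d⁻¹ : ℝ≥0) : ℝ≥0∞) := by
    rw [← NNReal.coe_inv]; simp [enorm_eq_nnnorm]
  simp only [e1, enorm_smul, mul_pow, hdn]
  have e2 := hem.lintegral_map (μ := volume) (fun z => ‖G z‖ₑ ^ 2 * w (e.symm z).2)
  rw [hd, lintegral_smul_measure] at e2
  simp only [LinearEquiv.symm_apply_apply] at e2
  have h3 := lintegral_enorm_sq_integral_prod_le hq hw H hk c (F := fun z => G (e z))
    (hGm.comp hec.measurable) hGe
  rw [← e2] at h3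
  calc _ = ((d⁻¹ : ℝ≥0) : ℝ≥0∞) ^ 2 * ∫⁻ r : ℝ, ∫⁻ x : ℝ, ‖∫ z : ℝ × V,
        cexp (I * ((x * (k * z.1) + r * (c * z.1 ^ 2 + q z.2) : ℝ) : ℂ)) * G (e z)‖ₑ ^ 2 := by
        have hne : ((d⁻¹ : ℝ≥0) : ℝ≥0∞) ^ 2 ≠ ⊤ := by finiteness
        simp only [lintegral_const_mul' _ _ hne]
    _ ≤ _ := mul_le_mul' le_rfl h3
    _ = _ := by
        rw [ENNReal.smul_def, smul_eq_mul, ENNReal.ofReal]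
        push_cast
        ring

/-! ### The bilinear L² estimate and the L⁶ Strichartz inequality. -/

/-- The free evolution with initial Fourier transform `g` (in Mathlib's normalization). -/
def evolution (g : ℝ → ℂ) (r x : ℝ) : ℂ :=
  ∫ ξ, cexp (I * ((x * (2 * Real.pi * ξ) + r * (-(2 * Real.pi * ξ) ^ 2) : ℝ) : ℂ)) * g ξ

theorem measurable_evolution {g : ℝ → ℂ} (hg : Measurable g) :
    Measurable (Function.uncurry (evolution g)) := by
  exact measurable_integral_cexp_mul (W := ℝ × ℝ)
    (q := fun z ξ => z.2 * (2 * Real.pi * ξ) + z.1 * (-(2 * Real.pi * ξ) ^ 2))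
    (F := fun _ ξ => g ξ) (by unfold Function.uncurry; fun_prop)
    (by unfold Function.uncurry; fun_prop)

/-- The linear change of variables `(a, y) ↦ (a + y, a - y)`. -/
def sumDiffEquiv : (ℝ × ℝ) ≃ₗ[ℝ] (ℝ × ℝ) where
  toFun z := (z.1 + z.2, z.1 - z.2)
  invFun z := ((z.1 + z.2) / 2, (z.1 - z.2) / 2)
  map_add' z w := by ext <;> simp <;> ring
  map_smul' c z := by ext <;> simp <;> ring
  left_inv z := by ext <;> simp
  right_inv z := by ext <;> simp <;> ring

/-- For frequencies a + y and a - y the sum is 2a and the sum of squares 2a² + 2y². The phase y²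
produces the weight 1/|y|, where y is half the frequency difference. -/
theorem exists_lintegral_enorm_sq_mul_evolution_le :
    ∃ C : ℝ≥0, ∀ g₁ g₂ : ℝ → ℂ, Measurable g₁ → Measurable g₂ → Integrable g₁ → Integrable g₂ →
      ∫⁻ r : ℝ, ∫⁻ x : ℝ, ‖evolution g₁ r x * evolution g₂ r x‖ₑ ^ 2
        ≤ C * ∫⁻ z : ℝ × ℝ, ‖g₁ z.1‖ₑ ^ 2 * ‖g₂ z.2‖ₑ ^ 2 * ENNReal.ofReal |z.1 - z.2|⁻¹ := by
  have hk : -(8 * Real.pi ^ 2) ≠ 0 := by simp [Real.pi_ne_zero]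
  have hk' : 4 * Real.pi ≠ 0 := by simp [Real.pi_ne_zero]
  obtain ⟨C, hC⟩ := exists_lintegral_enorm_sq_integral_le (V := ℝ)
    (q := fun y => -(8 * Real.pi ^ 2) * y ^ 2) (by fun_prop)
    (w := fun y => ENNReal.ofReal (4 * Real.pi / |-(8 * Real.pi ^ 2)|) * ENNReal.ofReal |y|⁻¹)
    (by fun_prop)
    (fun h hh => by
      refine (lintegral_enorm_sq_integral_cexp_sq_le hk hh).trans_eq ?_
      rw [← lintegral_const_mul' _ _ ENNReal.ofReal_ne_top]
      refine lintegral_congr fun y => by ring)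
    hk' (-(8 * Real.pi ^ 2)) sumDiffEquiv
    (S := fun z => 2 * Real.pi * z.1 + 2 * Real.pi * z.2)
    (Q := fun z => -(2 * Real.pi * z.1) ^ 2 + -(2 * Real.pi * z.2) ^ 2)
    (fun z => by simp [sumDiffEquiv]; ring) (fun z => by simp [sumDiffEquiv]; ring)
  refine ⟨C * ((4 * Real.pi / |-(8 * Real.pi ^ 2)|).toNNReal * 2), fun g₁ g₂ m₁ m₂ h₁ h₂ => ?_⟩
  have e : ∀ r x : ℝ, evolution g₁ r x * evolution g₂ r x =
      ∫ z : ℝ × ℝ, cexp (I * ((x * (2 * Real.pi * z.1 + 2 * Real.pi * z.2) +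
        r * (-(2 * Real.pi * z.1) ^ 2 + -(2 * Real.pi * z.2) ^ 2) : ℝ) : ℂ)) *
          (g₁ z.1 * g₂ z.2) := by
    intro r x
    rw [evolution, evolution, ← integral_prod_mul, Measure.volume_eq_prod]
    refine integral_congr_ae (ae_of_all _ fun z => ?_)
    simp only []
    rw [mul_mul_mul_comm, ← Complex.exp_add]
    congr 2
    push_cast; ring
  simp only [e]
  refine (hC (fun z => g₁ z.1 * g₂ z.2) (by fun_prop) (h₁.mul_prod h₂)).trans_eq ?_
  push_cast
  rw [mul_assoc]
  congr 1
  rw [← lintegral_const_mul' _ _ (by finiteness)]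
  refine lintegral_congr fun z => ?_
  have : |(sumDiffEquiv.symm z).2|⁻¹ = 2 * |z.1 - z.2|⁻¹ := by
    simp [sumDiffEquiv, abs_div]; ring
  rw [this, ENNReal.ofReal_mul (by positivity), enorm_mul, mul_pow, ENNReal.ofReal_ofNat]
  simp only [ENNReal.ofReal]
  ring

/-- Coordinates on `ℝ³` in which the first variable is proportional to the sum and the sum of
squares is a diagonal form that is isotropic in the other two. -/
def tripleEquiv : (ℝ × ℝ × ℝ) ≃ₗ[ℝ] (ℝ × ℝ × ℝ) where
  toFun z := (z.1 + z.2.1 + (√3)⁻¹ * z.2.2, z.1 - z.2.1 + (√3)⁻¹ * z.2.2, z.1 - 2 * (√3)⁻¹ * z.2.2)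
  invFun z := ((z.1 + z.2.1 + z.2.2) / 3, (z.1 - z.2.1) / 2, √3 * ((z.1 + z.2.1 - 2 * z.2.2) / 6))
  map_add' z w := by ext <;> simp <;> ring
  map_smul' c z := by ext <;> simp <;> ring
  left_inv z := by
    ext
    · simp; ring
    · simp
    · simp; field_simp; ring
  right_inv z := by
    ext <;> simp <;> field_simp <;> ring

/-- The sixth power is the square of the cube, an oscillatory integral over ℝ³. In the coordinates
(a, b, c) of `tripleEquiv` the sum is 3a and the sum of squares 3a² + 2(b² + c²), so the unweighted
plane inequality applies and the L² norm of the amplitude factorizes. -/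
theorem exists_lintegral_enorm_evolution_pow_six_le :
    ∃ C : ℝ≥0, ∀ g : ℝ → ℂ, Measurable g → Integrable g →
      ∫⁻ r : ℝ, ∫⁻ x : ℝ, ‖evolution g r x‖ₑ ^ 6 ≤ C * (∫⁻ ξ, ‖g ξ‖ₑ ^ 2) ^ 3 := by
  have hk : -(8 * Real.pi ^ 2) ≠ 0 := by simp [Real.pi_ne_zero]
  have hk' : 6 * Real.pi ≠ 0 := by simp [Real.pi_ne_zero]
  obtain ⟨C, hC⟩ := exists_lintegral_enorm_sq_integral_le (V := ℝ × ℝ)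
    (q := fun y => -(8 * Real.pi ^ 2) * (y.1 ^ 2 + y.2 ^ 2)) (by fun_prop)
    (w := fun _ => ENNReal.ofReal (2 * Real.pi / |-(8 * Real.pi ^ 2)|) *
      ENNReal.ofReal (2 * Real.pi))
    (by fun_prop)
    (fun h hh => by
      refine (lintegral_enorm_sq_integral_cexp_plane_le hk hh).trans_eq ?_
      rw [← lintegral_const_mul' _ _ (by finiteness)]
      refine lintegral_congr fun y => by ring)
    hk' (-(12 * Real.pi ^ 2)) tripleEquiv
    (S := fun z => 2 * Real.pi * z.1 + (2 * Real.pi * z.2.1 + 2 * Real.pi * z.2.2))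
    (Q := fun z => -(2 * Real.pi * z.1) ^ 2 +
      (-(2 * Real.pi * z.2.1) ^ 2 + -(2 * Real.pi * z.2.2) ^ 2))
    (fun z => by simp [tripleEquiv]; ring)
    (fun z => by
      have h3 : (√3 : ℝ)⁻¹ ^ 2 = 3⁻¹ := by rw [inv_pow, Real.sq_sqrt (by norm_num)]
      simp only [tripleEquiv, LinearEquiv.coe_mk, LinearMap.coe_mk, AddHom.coe_mk]
      linear_combination (-24 * Real.pi ^ 2 * z.2.2 ^ 2) * h3)
  refine ⟨C * ((2 * Real.pi / |-(8 * Real.pi ^ 2)|).toNNReal * (2 * Real.pi).toNNReal),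
    fun g m h => ?_⟩
  have e : ∀ r x : ℝ, ‖evolution g r x‖ₑ ^ 6 =
      ‖∫ z : ℝ × ℝ × ℝ, cexp (I * ((x * (2 * Real.pi * z.1 +
        (2 * Real.pi * z.2.1 + 2 * Real.pi * z.2.2)) +
        r * (-(2 * Real.pi * z.1) ^ 2 +
          (-(2 * Real.pi * z.2.1) ^ 2 + -(2 * Real.pi * z.2.2) ^ 2)) : ℝ) : ℂ)) *
          (g z.1 * (g z.2.1 * g z.2.2))‖ₑ ^ 2 := by
    intro r x
    rw [show 6 = 3 * 2 from rfl, pow_mul, ← enorm_pow]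
    congr 2
    rw [show evolution g r x ^ 3 = evolution g r x * (evolution g r x * evolution g r x) by ring]
    rw [evolution, ← integral_prod_mul, ← integral_prod_mul, ← Measure.volume_eq_prod,
      ← Measure.volume_eq_prod]
    refine integral_congr_ae (ae_of_all _ fun z => ?_)
    simp only []
    rw [mul_mul_mul_comm (cexp _) _ (cexp _), ← Complex.exp_add, mul_mul_mul_comm,
      ← Complex.exp_add]
    congr 2
    push_cast; ring
  simp only [e]
  refine (hC (fun z => g z.1 * (g z.2.1 * g z.2.2)) (by fun_prop)
    (h.mul_prod (h.mul_prod h))).trans_eq ?_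
  push_cast
  rw [mul_assoc]
  congr 1
  rw [lintegral_mul_const' _ _ (by finiteness), mul_comm]
  congr 1
  simp only [enorm_mul, mul_pow]
  rw [Measure.volume_eq_prod, lintegral_prod_mul (f := fun ξ => ‖g ξ‖ₑ ^ 2)
    (g := fun z : ℝ × ℝ => ‖g z.1‖ₑ ^ 2 * ‖g z.2‖ₑ ^ 2) (by fun_prop) (by fun_prop),
    Measure.volume_eq_prod, lintegral_prod_mul (f := fun ξ => ‖g ξ‖ₑ ^ 2)
    (g := fun ξ => ‖g ξ‖ₑ ^ 2) (by fun_prop) (by fun_prop)]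
  ring

/-! ### Interpolation between L² and L³. -/

/-- Hölder with weights 3 - p and p - 2, which sum to 1 and satisfy 2(3 - p) + 3(p - 2) = p. -/
theorem lintegral_rpow_le_of_sq_of_cube {α : Type*} [MeasurableSpace α] {μ : Measure α}
    {f : α → ℝ≥0∞} (hf : AEMeasurable f μ) {p : ℝ} (hp2 : 2 ≤ p) (hp3 : p < 3) :
    ∫⁻ a, f a ^ p ∂μ ≤ (∫⁻ a, f a ^ 2 ∂μ) ^ (3 - p) * (∫⁻ a, f a ^ 3 ∂μ) ^ (p - 2) := by
  have := ENNReal.lintegral_mul_norm_pow_le (μ := μ) (hf.pow_const 2) (hf.pow_const 3)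
    (p := 3 - p) (q := p - 2) (by linarith) (by linarith) (by ring)
  refine le_trans (le_of_eq (lintegral_congr fun a => ?_)) this
  rw [← ENNReal.rpow_natCast, ← ENNReal.rpow_natCast, ← ENNReal.rpow_mul, ← ENNReal.rpow_mul,
    ← ENNReal.rpow_add_of_nonneg]
  · congr 1; push_cast; ring
  · push_cast; linarith
  · push_cast; linarith

/-- Cauchy–Schwarz splits the cubed product into two sixth powers; no separation is needed. -/
theorem exists_lintegral_enorm_cube_mul_evolution_le :
    ∃ C : ℝ≥0, ∀ g₁ g₂ : ℝ → ℂ, Measurable g₁ → Measurable g₂ → Integrable g₁ → Integrable g₂ →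
      ∫⁻ z : ℝ × ℝ, ‖evolution g₁ z.1 z.2 * evolution g₂ z.1 z.2‖ₑ ^ 3
        ≤ C * ((∫⁻ ξ, ‖g₁ ξ‖ₑ ^ 2) * ∫⁻ ξ, ‖g₂ ξ‖ₑ ^ 2) ^ (3 / 2 : ℝ) := by
  obtain ⟨C, hC⟩ := exists_lintegral_enorm_evolution_pow_six_le
  refine ⟨C, fun g₁ g₂ m₁ m₂ h₁ h₂ => ?_⟩
  have M : ∀ g : ℝ → ℂ, Measurable g → Measurable fun z : ℝ × ℝ => ‖evolution g z.1 z.2‖ₑ ^ 6 :=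
    fun g m => (measurable_evolution m).enorm.pow_const 6
  have b : ∀ g : ℝ → ℂ, Measurable g → Integrable g →
      ∫⁻ z : ℝ × ℝ, ‖evolution g z.1 z.2‖ₑ ^ 6 ≤ C * (∫⁻ ξ, ‖g ξ‖ₑ ^ 2) ^ 3 := by
    intro g m h
    rw [Measure.volume_eq_prod, lintegral_prod _ (M g m).aemeasurable]
    exact hC g m h
  have h6 : ∀ x : ℝ≥0∞, (x ^ 6) ^ (1 / 2 : ℝ) = x ^ 3 := fun x => by
    rw [← ENNReal.rpow_natCast, ← ENNReal.rpow_mul, ← ENNReal.rpow_natCast]; norm_num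
  have := ENNReal.lintegral_mul_norm_pow_le (μ := volume) (M g₁ m₁).aemeasurable
    (M g₂ m₂).aemeasurable (p := 1 / 2) (q := 1 / 2) (by norm_num) (by norm_num) (by norm_num)
  simp only [h6, ← mul_pow, ← enorm_mul] at this
  refine this.trans ?_
  rw [← ENNReal.mul_rpow_of_nonneg _ _ (by norm_num)]
  calc _ ≤ ((C * (∫⁻ ξ, ‖g₁ ξ‖ₑ ^ 2) ^ 3) * (C * (∫⁻ ξ, ‖g₂ ξ‖ₑ ^ 2) ^ 3)) ^ (1 / 2 : ℝ) :=
        ENNReal.rpow_le_rpow (mul_le_mul' (b _ m₁ h₁) (b _ m₂ h₂)) (by norm_num)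
    _ = _ := by
        rw [mul_mul_mul_comm, ENNReal.mul_rpow_of_nonneg _ _ (by norm_num), ← mul_pow, ← pow_two]
        congr 1
        · rw [← ENNReal.rpow_natCast, ← ENNReal.rpow_mul]; norm_num
        · rw [← ENNReal.rpow_natCast, ← ENNReal.rpow_mul]; norm_num

/-- Where both data are nonzero the weight is at most `s⁻¹`. For `s = ∞` the product of the data
vanishes almost everywhere, in accordance with `s⁻¹ = 0`. -/
theorem exists_lintegral_enorm_sq_mul_evolution_le_of_separated :
    ∃ C : ℝ≥0, ∀ g₁ g₂ : ℝ → ℂ, Measurable g₁ → Measurable g₂ → Integrable g₁ → Integrable g₂ →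
      ∀ s : ℝ≥0∞, 0 < s →
      (∀ᵐ z : ℝ × ℝ, g₁ z.1 ≠ 0 → g₂ z.2 ≠ 0 → s ≤ ENNReal.ofReal |z.1 - z.2|) →
      ∫⁻ z : ℝ × ℝ, ‖evolution g₁ z.1 z.2 * evolution g₂ z.1 z.2‖ₑ ^ 2
        ≤ C * s⁻¹ * ((∫⁻ ξ, ‖g₁ ξ‖ₑ ^ 2) * ∫⁻ ξ, ‖g₂ ξ‖ₑ ^ 2) := by
  obtain ⟨C, hC⟩ := exists_lintegral_enorm_sq_mul_evolution_le
  refine ⟨C, fun g₁ g₂ m₁ m₂ h₁ h₂ s hs hsep => ?_⟩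
  have hm : Measurable fun z : ℝ × ℝ => ‖evolution g₁ z.1 z.2 * evolution g₂ z.1 z.2‖ₑ ^ 2 :=
    ((measurable_evolution m₁).mul (measurable_evolution m₂)).enorm.pow_const 2
  rw [Measure.volume_eq_prod, lintegral_prod _ hm.aemeasurable]
  refine (hC g₁ g₂ m₁ m₂ h₁ h₂).trans ?_
  rw [mul_assoc]
  refine mul_le_mul' le_rfl ?_
  calc _ ≤ ∫⁻ z : ℝ × ℝ, s⁻¹ * (‖g₁ z.1‖ₑ ^ 2 * ‖g₂ z.2‖ₑ ^ 2) := by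
        refine lintegral_mono_ae ?_
        filter_upwards [hsep] with z hz
        by_cases z1 : g₁ z.1 = 0
        · simp [z1]
        by_cases z2 : g₂ z.2 = 0
        · simp [z2]
        rw [mul_comm]
        refine mul_le_mul' ?_ le_rfl
        have h := hz z1 z2
        have hpos : 0 < |z.1 - z.2| := ENNReal.ofReal_pos.1 (hs.trans_le h)
        rw [ENNReal.ofReal_inv_of_pos hpos]
        exact ENNReal.inv_le_inv.2 h
    _ = _ := by
        rw [lintegral_const_mul _ (by fun_prop), Measure.volume_eq_prod,
          lintegral_prod_mul (f := fun ξ => ‖g₁ ξ‖ₑ ^ 2) (g := fun ξ => ‖g₂ ξ‖ₑ ^ 2)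
            (by fun_prop) (by fun_prop)]

/-- The fractional bilinear estimate for integrable frequency data. -/
theorem exists_lintegral_enorm_rpow_mul_evolution_le {p : ℝ} (hp2 : 2 ≤ p) (hp3 : p < 3) :
    ∃ C : ℝ≥0, ∀ g₁ g₂ : ℝ → ℂ, Measurable g₁ → Measurable g₂ → Integrable g₁ → Integrable g₂ →
      ∀ s : ℝ≥0∞, 0 < s →
      (∀ᵐ z : ℝ × ℝ, g₁ z.1 ≠ 0 → g₂ z.2 ≠ 0 → s ≤ ENNReal.ofReal |z.1 - z.2|) →
      ∫⁻ z : ℝ × ℝ, ‖evolution g₁ z.1 z.2 * evolution g₂ z.1 z.2‖ₑ ^ p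
        ≤ C * s⁻¹ ^ (3 - p) * ((∫⁻ ξ, ‖g₁ ξ‖ₑ ^ 2) * ∫⁻ ξ, ‖g₂ ξ‖ₑ ^ 2) ^ (p / 2) := by
  obtain ⟨C₂, hC₂⟩ := exists_lintegral_enorm_sq_mul_evolution_le_of_separated
  obtain ⟨C₃, hC₃⟩ := exists_lintegral_enorm_cube_mul_evolution_le
  have a3 : 0 ≤ 3 - p := by linarith
  have a2 : 0 ≤ p - 2 := by linarith
  refine ⟨C₂ ^ (3 - p) * C₃ ^ (p - 2), fun g₁ g₂ m₁ m₂ h₁ h₂ s hs hsep => ?_⟩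
  refine (lintegral_rpow_le_of_sq_of_cube (μ := volume)
    ((measurable_evolution m₁).mul (measurable_evolution m₂)).enorm.aemeasurable hp2 hp3).trans ?_
  refine (mul_le_mul' (ENNReal.rpow_le_rpow (hC₂ g₁ g₂ m₁ m₂ h₁ h₂ s hs hsep) a3)
    (ENNReal.rpow_le_rpow (hC₃ g₁ g₂ m₁ m₂ h₁ h₂) a2)).trans_eq ?_
  -- `N` enters to the power 1 from the square bound and 3/2 from the cube bound; the interpolation
  -- weights combine these to p/2.
  set N := (∫⁻ ξ, ‖g₁ ξ‖ₑ ^ 2) * ∫⁻ ξ, ‖g₂ ξ‖ₑ ^ 2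
  rw [ENNReal.mul_rpow_of_nonneg _ _ a3, ENNReal.mul_rpow_of_nonneg _ _ a3,
    ENNReal.mul_rpow_of_nonneg _ _ a2, ← ENNReal.rpow_mul,
    show p / 2 = (3 - p) + 3 / 2 * (p - 2) by ring,
    ENNReal.rpow_add_of_nonneg _ _ a3 (by positivity), ENNReal.coe_mul,
    ENNReal.coe_rpow_of_nonneg _ a3, ENNReal.coe_rpow_of_nonneg _ a2]
  ring

/-! ### Separation of the frequency supports. -/

/-- Each point off the essential support has a neighbourhood on which `g` vanishes almost
everywhere, and in a second countable space a locally null set is null. -/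
theorem ae_mem_essSupport (g : ℝ → ℂ) : ∀ᵐ η, g η ≠ 0 → η ∈ essSupport g := by
  have : volume (Function.support g \ essSupport g) = 0 := by
    refine measure_null_of_locally_null _ fun x hx => ?_
    have h := hx.2
    simp only [essSupport, Set.mem_ofPred_eq, not_forall, not_lt, nonpos_iff_eq_zero] at h
    obtain ⟨U, hU, hxU, h0⟩ := h
    refine ⟨U ∩ Function.support g, ?_, h0⟩
    rw [mem_nhdsWithin]
    exact ⟨U, hU, hxU, fun y hy => ⟨hy.1, hy.2.1⟩⟩
  rw [ae_iff]
  refine measure_mono_null (fun η hη => ?_) this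
  simpa [Classical.not_imp] using hη

theorem ae_fourier_mem_essSupport_hat (f : L2) :
    ∀ᵐ ξ : ℝ, (𝓕 f : L2) ξ ≠ 0 → 2 * Real.pi * ξ ∈ essSupport (hat f) := by
  have hpi : 2 * Real.pi ≠ 0 := Real.two_pi_pos.ne'
  have h : ∀ᵐ η ∂(volume.map (2 * Real.pi * ·)), hat f η ≠ 0 → η ∈ essSupport (hat f) := by
    rw [Real.map_volume_mul_left hpi]
    exact Measure.ae_smul_measure (ae_mem_essSupport _) _
  have h2 := ae_of_ae_map (by fun_prop) h
  filter_upwards [h2] with ξ hξ hne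
  refine hξ ?_
  rw [hat, mul_div_cancel_left₀ _ hpi]
  refine mul_ne_zero ?_ hne
  rw [ofReal_ne_zero]
  positivity

/-- The frequencies of `hat` are 2π times those of `𝓕`, whence the division by 2π. -/
theorem ae_setDist_le (f₁ f₂ : L2) : ∀ᵐ z : ℝ × ℝ, (𝓕 f₁ : L2) z.1 ≠ 0 → (𝓕 f₂ : L2) z.2 ≠ 0 →
    setDist (essSupport (hat f₁)) (essSupport (hat f₂)) / ENNReal.ofReal (2 * Real.pi)
      ≤ ENNReal.ofReal |z.1 - z.2| := by
  have h₁ := Measure.quasiMeasurePreserving_fst (μ := (volume : Measure ℝ))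
    (ν := (volume : Measure ℝ)) |>.ae (ae_fourier_mem_essSupport_hat f₁)
  have h₂ := Measure.quasiMeasurePreserving_snd (μ := (volume : Measure ℝ))
    (ν := (volume : Measure ℝ)) |>.ae (ae_fourier_mem_essSupport_hat f₂)
  rw [Measure.volume_eq_prod]
  filter_upwards [h₁, h₂] with z k₁ k₂ n₁ n₂
  refine ENNReal.div_le_of_le_mul ?_
  refine (iInf₂_le_of_le _ (k₁ n₁) (iInf₂_le _ (k₂ n₂))).trans_eq ?_
  rw [edist_dist, Real.dist_eq, ← mul_sub, abs_mul, abs_of_pos Real.two_pi_pos, mul_comm,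
    ENNReal.ofReal_mul (abs_nonneg _)]

/-! ### Frequency truncation and versions of the evolution. -/

/-- The Fourier transform of `f` restricted to frequencies in `[-n, n]`. -/
def truncation (f : L2) (n : ℕ) : ℝ → ℂ := (Set.Icc (-n : ℝ) n).indicator (𝓕 f : L2)

theorem measurable_fourier (f : L2) : Measurable ((𝓕 f : L2) : ℝ → ℂ) :=
  (Lp.stronglyMeasurable _).measurable

theorem measurable_truncation (f : L2) (n : ℕ) : Measurable (truncation f n) :=
  (measurable_fourier f).indicator measurableSet_Icc

theorem memLp_truncation (f : L2) (n : ℕ) : MemLp (truncation f n) 2 :=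
  (Lp.memLp _).indicator measurableSet_Icc

theorem integrable_truncation (f : L2) (n : ℕ) : Integrable (truncation f n) := by
  rw [truncation, integrable_indicator_iff measurableSet_Icc]
  exact ((Lp.memLp (𝓕 f : L2)).restrict _).integrable (by norm_num)

theorem lintegral_enorm_sq_eq (g : L2) : ∫⁻ x, ‖g x‖ₑ ^ 2 = ‖g‖ₑ ^ 2 := by
  have := eLpNorm_nnreal_pow_eq_lintegral (f := g) (μ := volume) (p := 2) (by norm_num)
  simp only [NNReal.coe_ofNat, ENNReal.coe_ofNat] at this
  rw [Lp.enorm_def]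
  exact_mod_cast this.symm

theorem enorm_fourier (f : L2) : ‖(𝓕 f : L2)‖ₑ = ‖f‖ₑ := by
  rw [← ofReal_norm, Lp.norm_fourier_eq, ofReal_norm]

theorem enorm_fourierInv (f : L2) : ‖(𝓕⁻ f : L2)‖ₑ = ‖f‖ₑ := by
  have : ‖(𝓕⁻ f : L2)‖ = ‖f‖ := (Lp.fourierTransformₗᵢ ℝ ℂ).symm.norm_map _
  rw [← ofReal_norm, this, ofReal_norm]

theorem lintegral_enorm_sq_truncation_le (f : L2) (n : ℕ) :
    ∫⁻ ξ, ‖truncation f n ξ‖ₑ ^ 2 ≤ ‖f‖ₑ ^ 2 := by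
  rw [← enorm_fourier, ← lintegral_enorm_sq_eq]
  refine lintegral_mono fun ξ => pow_le_pow_left' ?_ 2
  exact enorm_indicator_le_enorm_self _ _

theorem tendsto_lintegral_sub_truncation (f : L2) :
    Tendsto (fun n : ℕ => ∫⁻ ξ, ‖(𝓕 f : L2) ξ - truncation f n ξ‖ₑ ^ 2) atTop (𝓝 0) := by
  have := tendsto_lintegral_of_dominated_convergence (μ := (volume : Measure ℝ))
    (F := fun (n : ℕ) ξ => ‖(𝓕 f : L2) ξ - truncation f n ξ‖ₑ ^ 2) (f := fun _ => 0)
    (fun ξ => ‖(𝓕 f : L2) ξ‖ₑ ^ 2)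
    (fun n => ((measurable_fourier f).sub (measurable_truncation f n)).enorm.pow_const 2)
    (fun n => ae_of_all _ fun ξ => ?_) ?_ (ae_of_all _ fun ξ => ?_)
  · simpa using this
  · refine pow_le_pow_left' ?_ 2
    by_cases h : ξ ∈ Set.Icc (-n : ℝ) n <;> simp [truncation, h]
  · rw [lintegral_enorm_sq_eq]
    finiteness
  · refine tendsto_const_nhds.congr' ?_
    filter_upwards [eventually_ge_atTop ⌈|ξ|⌉₊] with n hn
    have : |ξ| ≤ n := (Nat.le_ceil _).trans (by exact_mod_cast hn)
    have h : ξ ∈ Set.Icc (-n : ℝ) n := abs_le.1 this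
    simp [truncation, h]

theorem evolution_eq_fourierInv (g : ℝ → ℂ) (r x : ℝ) :
    evolution g r x = 𝓕⁻ (fun ξ => symbol r ξ * g ξ) x := by
  rw [evolution, Real.fourierInv_eq']
  refine integral_congr_ae (ae_of_all _ fun ξ => ?_)
  simp only [smul_eq_mul, RCLike.inner_apply, conj_trivial, symbol]
  rw [← mul_assoc (cexp _), ← Complex.exp_add]
  congr 2
  push_cast; ring

/-- Plancherel with a unimodular symbol: the truncation error does not depend on r, so one sequence
of truncations serves all times. -/
theorem lintegral_enorm_sq_T_sub_evolution (f : L2) (n : ℕ) (r : ℝ) :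
    ∫⁻ x, ‖T r f x - evolution (truncation f n) r x‖ₑ ^ 2
      = ∫⁻ ξ, ‖(𝓕 f : L2) ξ - truncation f n ξ‖ₑ ^ 2 := by
  have hc : Continuous (symbol r) := by
    unfold symbol; fun_prop
  have hi : Integrable (fun ξ => symbol r ξ * truncation f n ξ) :=
    (integrable_truncation f n).bdd_mul (c := 1) hc.aestronglyMeasurable
      (ae_of_all _ fun ξ => (norm_symbol r ξ).le)
  have hm : MemLp (fun ξ => symbol r ξ * truncation f n ξ) 2 :=
    (memLp_truncation f n).of_le hi.1 (ae_of_all _ fun ξ => by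
      rw [norm_mul, norm_symbol, one_mul])
  have e : ∀ᵐ x, T r f x - evolution (truncation f n) r x
      = (𝓕⁻ ((memLp_symbol_mul r (𝓕 f)).toLp _ - hm.toLp _) : L2) x := by
    have hs : (𝓕⁻ ((memLp_symbol_mul r (𝓕 f)).toLp _ - hm.toLp _) : L2)
        = T r f - (𝓕⁻ (hm.toLp _) : L2) :=
      (Lp.fourierTransformₗᵢ ℝ ℂ).symm.map_sub _ _
    rw [hs]
    filter_upwards [Lp.coeFn_sub (T r f) (𝓕⁻ (hm.toLp _) : L2), fourierInv_toLp_ae_eq hi hm]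
      with x h1 h2
    rw [h1, Pi.sub_apply, h2, evolution_eq_fourierInv]
  rw [lintegral_congr_ae (g := fun x =>
    ‖(𝓕⁻ ((memLp_symbol_mul r (𝓕 f)).toLp _ - hm.toLp _) : L2) x‖ₑ ^ 2)
    (e.mono fun x hx => by simp only [hx]), lintegral_enorm_sq_eq, enorm_fourierInv,
    ← lintegral_enorm_sq_eq]
  refine lintegral_congr_ae ?_
  filter_upwards [Lp.coeFn_sub ((memLp_symbol_mul r (𝓕 f)).toLp _) (hm.toLp _),
    (memLp_symbol_mul r (𝓕 f)).coeFn_toLp, hm.coeFn_toLp] with ξ h1 h2 h3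
  have h4 : ‖symbol r ξ‖ₑ = 1 := by rw [← ofReal_norm, norm_symbol, ENNReal.ofReal_one]
  simp only [h1, Pi.sub_apply, h2, h3, ← mul_sub, enorm_mul, h4, one_mul]

/-- Along a suitable sequence of truncations the evolutions converge almost everywhere in space,
at every time. -/
theorem exists_tendsto_evolution_truncation (f : L2) : ∃ N : ℕ → ℕ, ∀ r : ℝ, ∀ᵐ x : ℝ,
    Tendsto (fun n => evolution (truncation f (N n)) r x) atTop (𝓝 (T r f x)) := by
  -- Summable squared errors: their sum over n has finite integral in x, hence is finite almost
  -- everywhere, and the errors tend to 0 there.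
  have hN : ∀ n : ℕ, ∃ N : ℕ,
      ∫⁻ ξ, ‖(𝓕 f : L2) ξ - truncation f N ξ‖ₑ ^ 2 ≤ (2⁻¹ : ℝ≥0∞) ^ n := fun n =>
    ((tendsto_lintegral_sub_truncation f).eventually_le_const
      (ENNReal.pow_pos (by norm_num) n)).exists
  choose N hN using hN
  refine ⟨N, fun r => ?_⟩
  have hm : ∀ n, AEMeasurable fun x => ‖T r f x - evolution (truncation f (N n)) r x‖ₑ ^ 2 := by
    intro n
    have h1 := (Lp.stronglyMeasurable (T r f)).measurable
    have h2 := (measurable_evolution (measurable_truncation f (N n))).comp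
      (measurable_prodMk_left (x := r))
    exact ((h1.sub h2).enorm.pow_const 2).aemeasurable
  have hsum : ∫⁻ x, ∑' n, ‖T r f x - evolution (truncation f (N n)) r x‖ₑ ^ 2 ≠ ⊤ := by
    rw [lintegral_tsum hm]
    simp only [lintegral_enorm_sq_T_sub_evolution]
    refine ne_top_of_le_ne_top ?_ (ENNReal.tsum_le_tsum hN)
    rw [ENNReal.tsum_geometric, ENNReal.one_sub_inv_two, inv_inv]
    norm_num
  filter_upwards [ae_lt_top' (AEMeasurable.tsum hm) hsum] with x hx
  have h0 := ENNReal.tendsto_atTop_zero_of_tsum_ne_top hx.ne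
  have h1 : Tendsto (fun n => ‖T r f x - evolution (truncation f (N n)) r x‖ₑ) atTop (𝓝 0) := by
    have := h0.ennrpow_const (1 / 2)
    simp only [← ENNReal.rpow_natCast, ← ENNReal.rpow_mul] at this
    simpa using this
  rw [tendsto_iff_edist_tendsto_0]
  refine h1.congr fun n => ?_
  rw [edist_comm, edist_eq_enorm_sub]

theorem exists_isFreeEvolution (f : L2) : ∃ u : ℝ × ℝ → ℂ, IsFreeEvolution f u := by
  obtain ⟨N, hN⟩ := exists_tendsto_evolution_truncation f
  -- The default value of `limUnder` where no limit exists does not spoil measurability, and for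
  -- every r it occurs only on a null set of x.
  refine ⟨fun z => limUnder atTop fun n => evolution (truncation f (N n)) z.1 z.2, ?_,
    ae_of_all _ fun r => ?_⟩
  · exact (StronglyMeasurable.limUnder fun n =>
      (measurable_evolution (measurable_truncation f (N n))).stronglyMeasurable).aestronglyMeasurable
  · filter_upwards [hN r] with x hx using hx.limUnder_eq

theorem IsFreeEvolution.ae_tendsto {f : L2} {u : ℝ × ℝ → ℂ} (hu : IsFreeEvolution f u)
    {N : ℕ → ℕ} (hN : ∀ r : ℝ, ∀ᵐ x : ℝ,
      Tendsto (fun n => evolution (truncation f (N n)) r x) atTop (𝓝 (T r f x))) :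
    ∀ᵐ z : ℝ × ℝ, Tendsto (fun n => evolution (truncation f (N n)) z.1 z.2) atTop (𝓝 (u z)) := by
  -- Passing from almost every x at almost every r to almost every point of the plane requires a
  -- measurable convergence set, so `u` is replaced by a measurable representative.
  have hmk := hu.1.ae_eq_mk
  set v := hu.1.mk u
  have hv : Measurable v := hu.1.stronglyMeasurable_mk.measurable
  have hmeas : MeasurableSet {z : ℝ × ℝ |
      Tendsto (fun n => evolution (truncation f (N n)) z.1 z.2) atTop (𝓝 (v z))} :=
    measurableSet_tendsto_fun
      (fun n => measurable_evolution (measurable_truncation f (N n))) hv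
  have hae : ∀ᵐ z : ℝ × ℝ,
      Tendsto (fun n => evolution (truncation f (N n)) z.1 z.2) atTop (𝓝 (v z)) := by
    rw [Measure.volume_eq_prod] at hmk ⊢
    refine (Measure.ae_prod_iff_ae_ae hmeas).2 ?_
    filter_upwards [hu.2, Measure.ae_ae_of_ae_prod hmk] with r h1 h2
    filter_upwards [h1, h2, hN r] with x k1 k2 k3
    rw [← k2, k1]
    exact k3
  filter_upwards [hae, hmk] with z h1 h2
  rwa [h2]

end FractionalBilinear

end

/-! ### Passage to L² data. -/

theorem lemma2p2 (p : ℝ) (hp2 : 2 ≤ p) (hp3 : p < 3) :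
    (∀ f : FractionalBilinear.L2, ∃ u : ℝ × ℝ → ℂ, FractionalBilinear.IsFreeEvolution f u) ∧
    ∃ C : ℝ≥0, ∀ f₁ f₂ : FractionalBilinear.L2, ∀ s : ℝ≥0∞,
      s = FractionalBilinear.setDist
        (FractionalBilinear.essSupport (FractionalBilinear.hat f₁))
        (FractionalBilinear.essSupport (FractionalBilinear.hat f₂)) →
      0 < s →
      ∀ u₁ u₂ : ℝ × ℝ → ℂ,
        FractionalBilinear.IsFreeEvolution f₁ u₁ → FractionalBilinear.IsFreeEvolution f₂ u₂ →
        eLpNorm (fun z => u₁ z * u₂ z) (ENNReal.ofReal p) (volume : Measure (ℝ × ℝ)) ≤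
          C * (s ^ ((3 - p) / p))⁻¹ * ‖f₁‖ₑ * ‖f₂‖ₑ := by
  refine ⟨FractionalBilinear.exists_isFreeEvolution, ?_⟩
  obtain ⟨C, hC⟩ := FractionalBilinear.exists_lintegral_enorm_rpow_mul_evolution_le hp2 hp3
  have hp : 0 < p := by linarith
  have hq : 0 ≤ (3 - p) / p := div_nonneg (by linarith) hp.le
  have hpi : 0 < 2 * Real.pi := Real.two_pi_pos
  -- The p-th root of the constant for integrable data, and the factor lost in rescaling `s` to `s`
  -- / 2π.
  refine ⟨C ^ (1 / p) * (2 * Real.pi).toNNReal ^ ((3 - p) / p),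
    fun f₁ f₂ s hs hs0 u₁ u₂ hu₁ hu₂ => ?_⟩
  obtain ⟨N₁, hN₁⟩ := FractionalBilinear.exists_tendsto_evolution_truncation f₁
  obtain ⟨N₂, hN₂⟩ := FractionalBilinear.exists_tendsto_evolution_truncation f₂
  set t : ℝ≥0∞ := s / ENNReal.ofReal (2 * Real.pi) with ht
  have ht0 : 0 < t := ENNReal.div_pos hs0.ne' ENNReal.ofReal_ne_top
  have hbound : ∀ n, ∫⁻ z : ℝ × ℝ,
      ‖FractionalBilinear.evolution (FractionalBilinear.truncation f₁ (N₁ n)) z.1 z.2 *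
        FractionalBilinear.evolution (FractionalBilinear.truncation f₂ (N₂ n)) z.1 z.2‖ₑ ^ p
      ≤ C * t⁻¹ ^ (3 - p) * (‖f₁‖ₑ ^ 2 * ‖f₂‖ₑ ^ 2) ^ (p / 2) := by
    intro n
    refine (hC _ _ (FractionalBilinear.measurable_truncation f₁ (N₁ n))
      (FractionalBilinear.measurable_truncation f₂ (N₂ n))
      (FractionalBilinear.integrable_truncation f₁ (N₁ n))
      (FractionalBilinear.integrable_truncation f₂ (N₂ n)) t ht0 ?_).trans ?_
    -- Truncation only shrinks the set where the data are nonzero, so the separation persists.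
    · filter_upwards [FractionalBilinear.ae_setDist_le f₁ f₂] with z hz h1 h2
      rw [ht, hs]
      exact hz (fun h => h1 (by simp [FractionalBilinear.truncation, Set.indicator, h]))
        (fun h => h2 (by simp [FractionalBilinear.truncation, Set.indicator, h]))
    · refine mul_le_mul' le_rfl (ENNReal.rpow_le_rpow (mul_le_mul' ?_ ?_) (by positivity))
      · exact FractionalBilinear.lintegral_enorm_sq_truncation_le _ _
      · exact FractionalBilinear.lintegral_enorm_sq_truncation_le _ _
  -- The bound is uniform in n and the truncated products converge almost everywhere, so Fatou
  -- applies.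
  have hfatou : ∫⁻ z : ℝ × ℝ, ‖u₁ z * u₂ z‖ₑ ^ p
      ≤ C * t⁻¹ ^ (3 - p) * (‖f₁‖ₑ ^ 2 * ‖f₂‖ₑ ^ 2) ^ (p / 2) := by
    have hlim : ∀ᵐ z : ℝ × ℝ, ‖u₁ z * u₂ z‖ₑ ^ p = Filter.liminf (fun n =>
        ‖FractionalBilinear.evolution (FractionalBilinear.truncation f₁ (N₁ n)) z.1 z.2 *
          FractionalBilinear.evolution (FractionalBilinear.truncation f₂ (N₂ n)) z.1 z.2‖ₑ ^ p)
        Filter.atTop := by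
      filter_upwards [hu₁.ae_tendsto hN₁, hu₂.ae_tendsto hN₂] with z h1 h2
      exact ((h1.mul h2).enorm.ennrpow_const p).liminf_eq.symm
    rw [lintegral_congr_ae hlim]
    refine (lintegral_liminf_le fun n => ?_).trans ?_
    · exact ((FractionalBilinear.measurable_evolution
        (FractionalBilinear.measurable_truncation f₁ (N₁ n))).mul
        (FractionalBilinear.measurable_evolution
        (FractionalBilinear.measurable_truncation f₂ (N₂ n)))).enorm.pow_const p
    · exact (Filter.liminf_le_liminf (Filter.Eventually.of_forall hbound)).trans_eq
        (Filter.liminf_const _)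
  rw [eLpNorm_eq_lintegral_rpow_enorm_toReal (by simpa using hp) ENNReal.ofReal_ne_top,
    ENNReal.toReal_ofReal hp.le]
  refine (ENNReal.rpow_le_rpow hfatou (by positivity)).trans_eq ?_
  have hip : 0 ≤ 1 / p := by positivity
  rw [ENNReal.mul_rpow_of_nonneg _ _ hip, ENNReal.mul_rpow_of_nonneg _ _ hip, ← mul_pow,
    ← ENNReal.rpow_natCast, ← ENNReal.rpow_mul, ← ENNReal.rpow_mul, ← ENNReal.rpow_mul,
    show (2 : ℕ) * (p / 2 * (1 / p)) = 1 by push_cast; field_simp, ENNReal.rpow_one,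
    show (3 - p) * (1 / p) = (3 - p) / p by ring, ht,
    ENNReal.inv_div (Or.inl ENNReal.ofReal_ne_top) (Or.inl (by simpa using hpi)),
    div_eq_mul_inv (ENNReal.ofReal _), ENNReal.mul_rpow_of_nonneg _ _ hq, ENNReal.inv_rpow, ENNReal.coe_mul,
    ENNReal.coe_rpow_of_nonneg _ hip, ENNReal.coe_rpow_of_nonneg _ hq, ENNReal.ofReal]
  ring
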